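/- Let $\mathbb N=\{1,2,\dots\}$. For $A\subset\mathbb N$ let $IP(A)\subset\mathbb Z$ be the set of all sums of finite subsets of $A$ (the empty sum $0$ included) and let $SIP(A)=IP(A)-IP(A)$. A set $B\subset\mathbb N$ is an SIP set if $SIP(A)\cap\mathbb N\subset B$ for some infinite $A\subset\mathbb N$. For a homeomorphism $T$ of a topological space $X$ and $U,V\subset X$ put $N(U,V)=\{n\in\mathbb N: T^n(U)\cap V\neq\emptyset\}$. Call $(X,T)$ mild mixing if for all nonempty open $U,V\subset X$ the set $N(U,V)$ meets every SIP set. Let $(X_i,T_i)_{i\in I}$ be any collection (finite or infinite) of mild mixing systems, where each $X_i$ is a compact metrizable space and $T_i$ is a homeomorphism of $X_i$. Then the product $\bigl(\prod_{i\in I}X_i,\ \prod_{i\in I}T_i\bigr)$, with the product topology and the coordinatewise homeomorphism, is mild mixing. Here $\prod_{i\in I} X_i$ is compact, and it is metrizable if $I$ is countable. -/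

import Mathlib

/-- The set of all sums `σ_F` of finite subsets `F` of `A ⊆ ℤ` (the empty sum `0` included). -/
def IPSums (A : Set ℤ) : Set ℤ :=
  {t | ∃ F : Finset ℤ, (F : Set ℤ) ⊆ A ∧ ∑ a ∈ F, a = t}

/-- `SIP(A) = IP(A) - IP(A)`, the set of differences of finite sums of elements of `A`. -/
def SIPSums (A : Set ℤ) : Set ℤ :=
  {t | ∃ s₁ ∈ IPSums A, ∃ s₂ ∈ IPSums A, t = s₁ - s₂}

/-- A set `B` of positive integers is an SIP set if it contains all the positive elements of
`SIP(A)` for some infinite set `A` of positive integers. -/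
def IsSIPSet (B : Set ℕ+) : Prop :=
  ∃ A : Set ℕ+, A.Infinite ∧ ∀ n : ℕ+, ((n : ℕ) : ℤ) ∈ SIPSums ((fun a : ℕ+ => ((a : ℕ) : ℤ)) '' A) → n ∈ B

/-- The family of all SIP sets. -/
def sipFamily : Set (Set ℕ+) := {B | IsSIPSet B}

/-- The dual of a family: the sets which meet every member of the family. -/
def dualFamily (F : Set (Set ℕ+)) : Set (Set ℕ+) :=
  {B | ∀ A ∈ F, (B ∩ A).Nonempty}

/-- The hitting time set `N(U,V)`: all `n ≥ 1` such that `T^n(U)` meets `V`. -/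
def hittingTimes {X : Type*} (T : X → X) (U V : Set X) : Set ℕ+ :=
  {n | (T^[(n : ℕ)] '' U ∩ V).Nonempty}

/-- `F` topological transitivity: `N(U,V)` belongs to `F` for all nonempty open `U` and `V`. -/
def IsFamilyTransitive {X : Type*} [TopologicalSpace X] (F : Set (Set ℕ+)) (T : X ≃ₜ X) : Prop :=
  ∀ U V : Set X, IsOpen U → IsOpen V → U.Nonempty → V.Nonempty → hittingTimes T U V ∈ F

/-- Mild mixing: topological transitivity for the dual of the family of SIP sets. -/
def IsMildMixing {X : Type*} [TopologicalSpace X] (T : X ≃ₜ X) : Prop :=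
  IsFamilyTransitive (dualFamily sipFamily) T

/-!
Differences of finite sums are handled as signed sums `∑_{i ∈ F} a i - ∑_{i ∈ G} a i` of a sequence
`a` of positive integers.  The sets meeting every SIP set do not obviously form a filter, so the sets `N(U_i, V_i)`
of the factors cannot simply be intersected; the dynamics has to be used a second time.

The key point is `HitsSignedSums.exists_returning_sequence`: if `W` is a nonempty open set of a
mild mixing system, then any `a` has a sequence `b` of signed sums of `a` over disjoint blocks
such that *every* positive signed sum of `b` is a return time of `W`.  One picks return times
`b k` of `W k` successively further out in `a`, with `W (k + 1) = W k ∩ T^{-b k} (W k)`; a point of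
`W k` then stays in `W` under all partial sums of `b 0, …, b (k - 1)`, and a signed sum is a passage
between two such partial sums.

For a finite box, `exists_common_hitting_time` proceeds by induction on the number of factors:
choose a signed sum `m` of `a` carrying `U` to `V` in one factor, put `W = U ∩ T^{-m} V`, and apply
the induction hypothesis to a sequence `b` as above, built from the part of `a` not used by `m`, and
to the targets `T_j^{-m} V_j` in the other factors.  The time `n` obtained is a return time of
`W`, so `n + m` is good for all factors, and it is again a signed sum of `a`.  Open sets of the full
product only constrain finitely many coordinates.
-/

open Finset

/-! ### Signed sums -/

/-- `t` is a difference of two subsums of the sequence `a`, both with indices in `I`.  The two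
index sets may overlap, as common terms cancel. -/
def IsSignedSum (a : ℕ → ℕ) (I : Finset ℕ) (t : ℤ) : Prop :=
  ∃ F ⊆ I, ∃ G ⊆ I, t = ∑ i ∈ F, (a i : ℤ) - ∑ i ∈ G, (a i : ℤ)

theorem isSignedSum_sum (a : ℕ → ℕ) (I : Finset ℕ) : IsSignedSum a I (∑ i ∈ I, (a i : ℤ)) :=
  ⟨I, subset_rfl, ∅, empty_subset _, by simp⟩

theorem IsSignedSum.mono {a : ℕ → ℕ} {I J : Finset ℕ} {t : ℤ} (h : IsSignedSum a I t)
    (hIJ : I ⊆ J) : IsSignedSum a J t := by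
  obtain ⟨F, hF, G, hG, rfl⟩ := h
  exact ⟨F, hF.trans hIJ, G, hG.trans hIJ, rfl⟩

theorem IsSignedSum.neg {a : ℕ → ℕ} {I : Finset ℕ} {t : ℤ} (h : IsSignedSum a I t) :
    IsSignedSum a I (-t) := by
  obtain ⟨F, hF, G, hG, rfl⟩ := h
  exact ⟨G, hG, F, hF, by ring⟩

theorem IsSignedSum.add {a : ℕ → ℕ} {I J : Finset ℕ} {s t : ℤ} (hs : IsSignedSum a I s)
    (ht : IsSignedSum a J t) (hIJ : Disjoint I J) : IsSignedSum a (I ∪ J) (s + t) := by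
  obtain ⟨F, hF, G, hG, rfl⟩ := hs
  obtain ⟨F', hF', G', hG', rfl⟩ := ht
  refine ⟨F ∪ F', union_subset_union hF hF', G ∪ G', union_subset_union hG hG', ?_⟩
  rw [sum_union (disjoint_of_subset_left hF (disjoint_of_subset_right hF' hIJ)),
    sum_union (disjoint_of_subset_left hG (disjoint_of_subset_right hG' hIJ))]
  ring

theorem IsSignedSum.sum {a : ℕ → ℕ} {b : ℕ → ℤ} {I : ℕ → Finset ℕ}
    (hb : ∀ j, IsSignedSum a (I j) (b j)) (hI : Pairwise fun j k => Disjoint (I j) (I k))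
    (S : Finset ℕ) : IsSignedSum a (S.biUnion I) (∑ j ∈ S, b j) := by
  induction S using Finset.induction_on with
  | empty => exact ⟨∅, by simp, ∅, by simp, by simp⟩
  | insert j S hj ih =>
    rw [sum_insert hj, biUnion_insert]
    refine (hb j).add ih ((disjoint_biUnion_right _ _ _).2 fun k hk => hI ?_)
    rintro rfl
    exact hj hk

/-- Signed sums of signed sums over disjoint blocks are signed sums. -/
theorem IsSignedSum.trans {a b : ℕ → ℕ} {I : ℕ → Finset ℕ} {J : Finset ℕ} {t : ℤ}
    (ht : IsSignedSum b J t) (hb : ∀ j, IsSignedSum a (I j) (b j))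
    (hI : Pairwise fun j k => Disjoint (I j) (I k)) : IsSignedSum a (J.biUnion I) t := by
  obtain ⟨F, hF, G, hG, rfl⟩ := ht
  -- Terms common to `F` and `G` are cancelled, so that each block is used with a single sign.
  have key := (IsSignedSum.sum hb hI (F \ G)).add (IsSignedSum.sum hb hI (G \ F)).neg <| by
    simp only [disjoint_biUnion_left, disjoint_biUnion_right]
    intro j hj k hk
    refine hI ?_
    rintro rfl
    exact (mem_sdiff.1 hj).2 (mem_sdiff.1 hk).1
  rw [← sub_eq_add_neg, sum_sdiff_sub_sum_sdiff] at key
  exact key.mono (union_subset (biUnion_subset_biUnion_of_subset_left _ (sdiff_subset.trans hF))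
    (biUnion_subset_biUnion_of_subset_left _ (sdiff_subset.trans hG)))

theorem IsSignedSum.of_shift {a : ℕ → ℕ} {m : ℕ} {J : Finset ℕ} {t : ℤ}
    (h : IsSignedSum (fun i => a (i + m)) J t) :
    ∃ M, IsSignedSum a (Ico m M) t := by
  have h' := h.trans (a := a) (I := fun j => {j + m})
    (fun j => by simpa using isSignedSum_sum a {j + m}) (fun j k hjk => by simpa using hjk)
  refine ⟨J.sup id + m + 1, h'.mono fun i hi => ?_⟩
  simp only [mem_biUnion, mem_singleton] at hi
  obtain ⟨j, hj, rfl⟩ := hi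
  have : j ≤ J.sup id := le_sup (f := id) hj
  simp only [mem_Ico]
  omega

theorem pairwise_disjoint_Ico {e : ℕ → ℕ} (he : Monotone e) :
    Pairwise fun j k => Disjoint (Ico (e j) (e (j + 1))) (Ico (e k) (e (k + 1))) := by
  have key : ∀ j k, j < k → Disjoint (Ico (e j) (e (j + 1))) (Ico (e k) (e (k + 1))) := by
    intro j k hjk
    rw [Finset.disjoint_left]
    intro x hx hx'
    have := he (Nat.succ_le_of_lt hjk)
    simp only [mem_Ico, Nat.succ_eq_add_one] at *
    omega
  intro j k hjk
  rcases lt_or_gt_of_ne hjk with h | h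
  · exact key j k h
  · exact (key k j h).symm

/-- Grouping a sequence of positive integers into consecutive blocks makes it strictly
increasing. -/
theorem exists_strictMono_block_sums {a : ℕ → ℕ} (ha : ∀ i, 0 < a i) :
    ∃ e : ℕ → ℕ, Monotone e ∧ StrictMono fun k => ∑ i ∈ Ico (e k) (e (k + 1)), a i := by
  -- Since all terms are at least `1`, a block longer than the sum of all the previous terms
  -- has a larger sum than every previous block.
  let e : ℕ → ℕ := fun k => Nat.rec 0 (fun _ m => m + ((∑ i ∈ range m, a i) + 1)) k
  have hsucc : ∀ k, e (k + 1) = e k + ((∑ i ∈ range (e k), a i) + 1) := fun k => rfl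
  refine ⟨e, monotone_nat_of_le_succ fun k => by rw [hsucc]; omega,
    strictMono_nat_of_lt_succ fun k => ?_⟩
  calc ∑ i ∈ Ico (e k) (e (k + 1)), a i
      ≤ ∑ i ∈ range (e (k + 1)), a i :=
        sum_le_sum_of_subset fun i hi => mem_range.2 (mem_Ico.1 hi).2
    _ < (∑ i ∈ range (e (k + 1)), a i) + 1 := Nat.lt_succ_self _
    _ = #(Ico (e (k + 1)) (e (k + 1 + 1))) := by rw [Nat.card_Ico, hsucc (k + 1)]; omega
    _ ≤ ∑ i ∈ Ico (e (k + 1)) (e (k + 1 + 1)), a i := by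
        rw [card_eq_sum_ones]; exact sum_le_sum fun i _ => ha i

/-! ### SIP sets and signed sums -/

/-- The positive signed sums of a sequence of positive integers form an SIP set; the sequence
need not be injective. -/
theorem isSIPSet_signedSums {a : ℕ → ℕ} (ha : ∀ i, 0 < a i) :
    IsSIPSet {n | ∃ I, IsSignedSum a I (n : ℕ)} := by
  obtain ⟨e, he, hmono⟩ := exists_strictMono_block_sums ha
  let b : ℕ → ℕ := fun k => ∑ i ∈ Ico (e k) (e (k + 1)), a i
  have hbpos : ∀ k, 0 < b (k + 1) := fun k => (Nat.zero_le _).trans_lt (hmono k.lt_succ_self)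
  let c : ℕ → ℕ+ := fun k => ⟨b (k + 1), hbpos k⟩
  have hc : Function.Injective c := fun j k h => by
    have := hmono.injective (congrArg PNat.val h : b (j + 1) = b (k + 1))
    omega
  refine ⟨Set.range c, Set.infinite_range_of_injective hc, ?_⟩
  have hinj : Function.Injective fun k => ((b (k + 1) : ℕ) : ℤ) := fun j k h =>
    hc (PNat.eq (Nat.cast_injective (R := ℤ) h))
  have himage : ((fun x : ℕ+ => ((x : ℕ) : ℤ)) '' Set.range c) =
      Set.range fun k => ((b (k + 1) : ℕ) : ℤ) := by
    rw [← Set.range_comp]; rfl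
  -- A finite set of values of `b` is turned back into a finite set of indices.
  have hindex : ∀ s ∈ IPSums ((fun x : ℕ+ => ((x : ℕ) : ℤ)) '' Set.range c),
      ∃ F : Finset ℕ, s = ∑ k ∈ F, ((b (k + 1) : ℕ) : ℤ) := by
    rintro s ⟨F, hF, rfl⟩
    rw [himage] at hF
    refine ⟨F.preimage _ hinj.injOn, ?_⟩
    exact (sum_preimage _ F hinj.injOn (fun x => x) fun x hx hx' => (hx' (hF hx)).elim).symm
  rintro n ⟨s, hs, t, ht, hn⟩
  obtain ⟨F, rfl⟩ := hindex s hs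
  obtain ⟨G, rfl⟩ := hindex t ht
  have hsum : IsSignedSum (fun k => b (k + 1)) (F ∪ G) (n : ℕ) :=
    ⟨F, subset_union_left, G, subset_union_right, hn⟩
  refine ⟨_, hsum.trans (a := a) (I := fun k => Ico (e (k + 1)) (e (k + 1 + 1)))
    (fun k => ?_) fun j k hjk => pairwise_disjoint_Ico he (by simpa using hjk)⟩
  have := isSignedSum_sum a (Ico (e (k + 1)) (e (k + 1 + 1)))
  simpa [b] using this

/-- Every SIP set contains the positive signed sums of a sequence of positive integers. -/
theorem IsSIPSet.exists_sequence {B : Set ℕ+} (hB : IsSIPSet B) :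
    ∃ a : ℕ → ℕ, (∀ i, 0 < a i) ∧ ∀ (n : ℕ+) (I : Finset ℕ), IsSignedSum a I (n : ℕ) → n ∈ B := by
  obtain ⟨A, hA, hAB⟩ := hB
  let f := hA.natEmbedding
  have hinj : Function.Injective fun i => (((f i : ℕ+) : ℕ) : ℤ) := fun i j h =>
    f.injective (Subtype.ext (PNat.eq (Nat.cast_injective (R := ℤ) h)))
  have hIP : ∀ F : Finset ℕ, ∑ i ∈ F, (((f i : ℕ+) : ℕ) : ℤ) ∈
      IPSums ((fun x : ℕ+ => ((x : ℕ) : ℤ)) '' A) := fun F =>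
    ⟨F.map ⟨_, hinj⟩, by
      intro x hx
      simp only [coe_map, Set.mem_image] at hx
      obtain ⟨i, -, rfl⟩ := hx
      exact ⟨f i, (f i).2, rfl⟩, by simp⟩
  refine ⟨fun i => ((f i : ℕ+) : ℕ), fun i => (f i : ℕ+).pos, ?_⟩
  rintro n I ⟨F, -, G, -, h⟩
  exact hAB n ⟨_, hIP F, _, hIP G, h⟩

/-! ### Return times along signed sums -/

/-- For all nonempty open `U` and `V`, some positive signed sum of any given sequence of positive
integers is a hitting time from `U` to `V`. -/
def HitsSignedSums {X : Type*} [TopologicalSpace X] (T : X → X) : Prop :=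
  ∀ U V : Set X, IsOpen U → IsOpen V → U.Nonempty → V.Nonempty →
    ∀ a : ℕ → ℕ, (∀ i, 0 < a i) →
      ∃ n : ℕ, 0 < n ∧ (∃ I, IsSignedSum a I n) ∧ ∃ x ∈ U, T^[n] x ∈ V

theorem IsMildMixing.hitsSignedSums {X : Type*} [TopologicalSpace X] {T : X ≃ₜ X}
    (hT : IsMildMixing T) : HitsSignedSums T := by
  intro U V hU hV hUne hVne a ha
  obtain ⟨n, ⟨_, ⟨x, hx, rfl⟩, hxV⟩, hn⟩ := hT U V hU hV hUne hVne _ (isSIPSet_signedSums ha)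
  exact ⟨n, n.pos, hn, x, hx, hxV⟩

theorem HitsSignedSums.exists_in_tail {X : Type*} [TopologicalSpace X] {T : X → X}
    (hT : HitsSignedSums T) {U V : Set X} (hU : IsOpen U) (hV : IsOpen V) (hUne : U.Nonempty)
    (hVne : V.Nonempty) {a : ℕ → ℕ} (ha : ∀ i, 0 < a i) (m : ℕ) :
    ∃ n M : ℕ, 0 < n ∧ m ≤ M ∧ IsSignedSum a (Ico m M) n ∧ (U ∩ T^[n] ⁻¹' V).Nonempty := by
  obtain ⟨n, hn, ⟨I, hI⟩, x, hx, hxV⟩ := hT U V hU hV hUne hVne _ fun i => ha (i + m)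
  obtain ⟨M, hM⟩ := hI.of_shift
  exact ⟨n, max m M, hn, le_max_left _ _, hM.mono (Ico_subset_Ico_right (le_max_right _ _)),
    x, hx, hxV⟩

/-- If each `W (k + 1)` and its translate by `b k` stay in `W k`, then all partial sums of
`b 0, …, b (k - 1)` carry `W k` into `W 0`. -/
theorem iterate_sum_mem {X : Type*} {T : X → X} {W : ℕ → Set X} {b : ℕ → ℕ}
    (hW : ∀ k, W (k + 1) ⊆ W k ∩ T^[b k] ⁻¹' W k) :
    ∀ k, ∀ F ⊆ range k, ∀ x ∈ W k, T^[∑ j ∈ F, b j] x ∈ W 0 := by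
  intro k
  induction k with
  | zero =>
    intro F hF x hx
    simpa [subset_empty.1 (by simpa using hF)] using hx
  | succ k ih =>
    intro F hF x hx
    have hsub : F.erase k ⊆ range k := by
      intro j hj
      have h1 := mem_range.1 (hF (mem_of_mem_erase hj))
      have h2 := ne_of_mem_erase hj
      rw [mem_range]
      omega
    by_cases hk : k ∈ F
    · rw [← sum_erase_add F b hk, Function.iterate_add_apply]
      exact ih _ hsub _ (hW k hx).2
    · rw [← erase_eq_of_notMem hk]
      exact ih _ hsub _ (hW k hx).1

/-- A nonempty open set `W` has a sequence of signed sums of `a` over disjoint blocks, as far out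
as desired, all of whose nonnegative signed sums are return times of `W`. -/
theorem HitsSignedSums.exists_returning_sequence {X : Type*} [TopologicalSpace X] {T : X → X}
    (hT : HitsSignedSums T) (hTc : Continuous T) {W : Set X} (hW : IsOpen W) (hWne : W.Nonempty)
    {a : ℕ → ℕ} (ha : ∀ i, 0 < a i) (m : ℕ) :
    ∃ (b : ℕ → ℕ) (e : ℕ → ℕ), (∀ k, 0 < b k) ∧ Monotone e ∧ m ≤ e 0 ∧
      (∀ k, IsSignedSum a (Ico (e k) (e (k + 1))) (b k)) ∧
      ∀ (n : ℕ) (I : Finset ℕ), IsSignedSum b I n → ∃ x ∈ W, T^[n] x ∈ W := by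
  -- A state is the current open set together with the first index of `a` not used so far.
  let State := {U : Set X // IsOpen U ∧ U.Nonempty} × ℕ
  have step : ∀ p : State, ∃ n M : ℕ, 0 < n ∧ p.2 ≤ M ∧ IsSignedSum a (Ico p.2 M) n ∧
      (p.1.1 ∩ T^[n] ⁻¹' p.1.1).Nonempty := fun p =>
    hT.exists_in_tail p.1.2.1 p.1.2.1 p.1.2.2 p.1.2.2 ha p.2
  choose r M hr hM hsum hne using step
  let next : State → State := fun p =>
    (⟨p.1.1 ∩ T^[r p] ⁻¹' p.1.1, p.1.2.1.inter (p.1.2.1.preimage (hTc.iterate _)), hne p⟩, M p)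
  let s : ℕ → State := fun k => next^[k] (⟨W, hW, hWne⟩, m)
  have hs : ∀ k, s (k + 1) = next (s k) := fun k => Function.iterate_succ_apply' next k _
  have hb : ∀ k, (s (k + 1)).1.1 ⊆ (s k).1.1 ∩ T^[r (s k)] ⁻¹' (s k).1.1 := fun k => by
    rw [hs k]
  have he : ∀ k, (s (k + 1)).2 = M (s k) := fun k => by rw [hs k]
  refine ⟨fun k => r (s k), fun k => (s k).2, fun k => hr _, monotone_nat_of_le_succ fun k => ?_,
    le_rfl, fun k => ?_, ?_⟩
  · rw [he k]; exact hM _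
  · beta_reduce; rw [he k]; exact hsum _
  · rintro n I ⟨F, hF, G, hG, hn⟩
    have hI : I ⊆ range (I.sup id + 1) := fun i hi =>
      mem_range.2 (Nat.lt_succ_of_le (le_sup (f := id) hi))
    obtain ⟨x, hx⟩ := (s (I.sup id + 1)).1.2.2
    have key := iterate_sum_mem (W := fun k => (s k).1.1) (b := fun k => r (s k)) hb
    -- The time `n` leads from the point reached after the sum over `G` to that over `F`.
    refine ⟨_, key _ G (hG.trans hI) x hx, ?_⟩
    rw [← Function.iterate_add_apply]
    have : n + ∑ j ∈ G, r (s j) = ∑ j ∈ F, r (s j) := by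
      zify
      linarith
    rw [this]
    exact key _ F (hF.trans hI) x hx

/-! ### Products -/

theorem exists_common_hitting_time {ι : Type*} {X : ι → Type*} [∀ i, TopologicalSpace (X i)]
    {T : ∀ i, X i → X i} (hTc : ∀ i, Continuous (T i)) (hTs : ∀ i, (T i).Surjective)
    (hT : ∀ i, HitsSignedSums (T i))
    {U : ∀ i, Set (X i)} (hU : ∀ i, IsOpen (U i)) (hUne : ∀ i, (U i).Nonempty) (J : Finset ι) :
    ∀ V : ∀ i, Set (X i), (∀ i, IsOpen (V i)) → (∀ i, (V i).Nonempty) →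
      ∀ a : ℕ → ℕ, (∀ i, 0 < a i) →
        ∃ n : ℕ, 0 < n ∧ (∃ I, IsSignedSum a I n) ∧ ∀ i ∈ J, ∃ x ∈ U i, (T i)^[n] x ∈ V i := by
  classical
  induction J using Finset.induction_on with
  | empty =>
    intro V _ _ a ha
    exact ⟨a 0, ha 0, ⟨{0}, by simpa using isSignedSum_sum a {0}⟩, by simp⟩
  | insert i J hi ih =>
    intro V hV hVne a ha
    obtain ⟨m, M, -, -, hm, hWne⟩ := (hT i).exists_in_tail (hU i) (hV i) (hUne i) (hVne i) ha 0
    obtain ⟨b, e, hbpos, he, hMe, hb, hret⟩ := (hT i).exists_returning_sequence (hTc i)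
      ((hU i).inter ((hV i).preimage ((hTc i).iterate m))) hWne ha M
    obtain ⟨n, hn, ⟨I, hI⟩, hJ⟩ := ih (fun j => (T j)^[m] ⁻¹' V j)
      (fun j => (hV j).preimage ((hTc j).iterate m))
      (fun j => (hVne j).preimage ((hTs j).iterate m)) b hbpos
    refine ⟨m + n, by omega, ⟨Ico 0 M ∪ I.biUnion fun k => Ico (e k) (e (k + 1)), ?_⟩, ?_⟩
    · rw [Nat.cast_add]
      refine hm.add (hI.trans hb (pairwise_disjoint_Ico he)) ?_
      rw [disjoint_biUnion_right]
      intro k _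
      rw [Finset.disjoint_left]
      intro x hx hx'
      have := he (Nat.zero_le k)
      simp only [mem_Ico] at hx hx'
      omega
    · intro j hj
      rcases mem_insert.1 hj with rfl | hj
      · obtain ⟨x, hx, hx'⟩ := hret n I hI
        refine ⟨x, hx.1, ?_⟩
        rw [Function.iterate_add_apply]
        exact hx'.2
      · obtain ⟨x, hx, hx'⟩ := hJ j hj
        refine ⟨x, hx, ?_⟩
        rw [Function.iterate_add_apply]
        exact hx'

/-- A nonempty open subset of a product contains a nonempty open box whose sides are proper only
at finitely many coordinates. -/
theorem IsOpen.exists_box_subset {ι : Type*} {X : ι → Type*} [∀ i, TopologicalSpace (X i)]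
    {U : Set (∀ i, X i)} (hU : IsOpen U) (hUne : U.Nonempty) :
    ∃ (J : Finset ι) (u : ∀ i, Set (X i)), (∀ i, IsOpen (u i)) ∧ (∀ i, (u i).Nonempty) ∧
      (J : Set ι).pi u ⊆ U := by
  classical
  obtain ⟨x, hx⟩ := hUne
  obtain ⟨J, u, hu, hsub⟩ := isOpen_pi_iff.1 hU x hx
  refine ⟨J, fun i => if i ∈ J then u i else Set.univ, fun i => ?_, fun i => ⟨x i, ?_⟩, ?_⟩
  · dsimp only
    split_ifs with h
    exacts [(hu i h).1, isOpen_univ]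
  · dsimp only
    split_ifs with h
    exacts [(hu i h).2, trivial]
  · intro y hy
    refine hsub fun i hi => ?_
    simpa only [if_pos (mem_coe.1 hi)] using hy i hi

theorem IsMildMixing.piCongrRight {ι : Type*} {X : ι → Type*} [∀ i, TopologicalSpace (X i)]
    {T : ∀ i, X i ≃ₜ X i} (hT : ∀ i, IsMildMixing (T i)) :
    IsMildMixing (Homeomorph.piCongrRight T) := by
  classical
  intro U V hU hV hUne hVne B hB
  obtain ⟨J, u, hu, hune, huU⟩ := hU.exists_box_subset hUne
  obtain ⟨K, v, hv, hvne, hvV⟩ := hV.exists_box_subset hVne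
  obtain ⟨a, ha, haB⟩ := IsSIPSet.exists_sequence hB
  obtain ⟨n, hn, ⟨I, hI⟩, h⟩ := exists_common_hitting_time (fun i => (T i).continuous)
    (fun i => (T i).surjective) (fun i => (hT i).hitsSignedSums) hu hune (J ∪ K) v hv hvne a ha
  have hiter : ∀ (k : ℕ) (x : ∀ i, X i) (i : ι),
      ((Homeomorph.piCongrRight T)^[k] x) i = (T i)^[k] (x i) := by
    intro k
    induction k with
    | zero => intro x i; rfl
    | succ k ih => intro x i; rw [Function.iterate_succ_apply, ih]; rfl
  -- The remaining coordinates are unconstrained.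
  have hpt : ∀ i, ∃ y, i ∈ J ∪ K → y ∈ u i ∧ (T i)^[n] y ∈ v i := fun i => by
    by_cases hi : i ∈ J ∪ K
    · obtain ⟨y, hy, hy'⟩ := h i hi
      exact ⟨y, fun _ => ⟨hy, hy'⟩⟩
    · exact ⟨(hune i).some, fun h => (hi h).elim⟩
  choose y hy using hpt
  refine ⟨⟨n, hn⟩, ⟨_, ⟨y, huU fun i hi => (hy i (mem_union_left _ hi)).1, rfl⟩,
    hvV fun i hi => ?_⟩, haB ⟨n, hn⟩ I hI⟩
  rw [PNat.mk_coe, hiter]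
  exact (hy i (mem_union_right _ hi)).2

theorem mainTheorem8 {ι : Type*} (X : ι → Type*) [∀ i, TopologicalSpace (X i)]
    [∀ i, CompactSpace (X i)] [∀ i, TopologicalSpace.MetrizableSpace (X i)]
    (T : ∀ i, X i ≃ₜ X i) (hT : ∀ i, IsMildMixing (T i)) :
    CompactSpace (∀ i, X i) ∧
      (Countable ι → TopologicalSpace.MetrizableSpace (∀ i, X i)) ∧
      IsMildMixing (Homeomorph.piCongrRight T) := by
  exact ⟨inferInstance, fun _ => inferInstance, IsMildMixing.piCongrRight hT⟩
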